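/- For a finite graph $G$, let $\gamma_e(G)$ be the smallest size of a set $\Gamma$ of edges of $G$ such that every edge of $G$ shares a vertex with some edge in $\Gamma$. For a prime power $q$, let $D$ be the design of points and lines of the Desarguesian projective plane $\mathrm{PG}(2,q)$ over $\mathbb{F}_q$, and let $\gamma_e(D)$ denote $\gamma_e$ of its incidence graph, i.e. the bipartite graph whose vertices are the points and the lines, a point being adjacent to a line exactly when it lies on it. There is an absolute constant $C$ such that, for every prime $p$ and every integer $h\ge 1$ for which $q=p^h\ge 101$, $$q^2-q\sqrt q-Cq\;\le\;\gamma_e(D)\;\le\; q^2-c\,q\sqrt q+Cq,$$ where $$c=\begin{cases}1 & \text{if } p=2 \text{ and } h \text{ is even},\\ \frac1{\sqrt2} & \text{if } p=2 \text{ and } h \text{ is odd},\\ \frac12 & \text{if } p \text{ is odd and } h \text{ is even},\\ 0.19 & \text{if } p \text{ is odd and } h \text{ is odd}.\end{cases}$$ -/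

import Mathlib

open scoped LinearAlgebra.Projectivization

/-- An incidence structure with point set `P`: a collection of subsets of `P`, called blocks.
A point is incident with a block if it belongs to it. -/
structure IncidenceStructure (P : Type*) where
  blocks : Set (Set P)

/-- The incidence (Levi) graph: the bipartite graph on points and blocks in which a point and a
block are adjacent exactly when they are incident. -/
def IncidenceStructure.incidenceGraph {P : Type*} (D : IncidenceStructure P) :
    SimpleGraph (P ⊕ D.blocks) where
  Adj
    | Sum.inl x, Sum.inr B => x ∈ (B : Set P)
    | Sum.inr B, Sum.inl x => x ∈ (B : Set P)
    | _, _ => False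
  symm := ⟨by rintro (x | B) (y | B') h <;> exact h⟩
  loopless := ⟨by rintro (x | B) h <;> exact h⟩

/-- `Γ` is a set of edges of `G` such that every edge of `G` shares a vertex with some edge
in `Γ`. -/
def IsEdgeDominatingSet {V : Type*} (G : SimpleGraph V) (Γ : Finset (Sym2 V)) : Prop :=
  (∀ e ∈ Γ, e ∈ G.edgeSet) ∧ ∀ e ∈ G.edgeSet, ∃ e' ∈ Γ, ∃ v, v ∈ e' ∧ v ∈ e

/-- The edge domination number of a finite graph: the smallest size of an edge dominating set. -/
noncomputable def edgeDominationNumber {V : Type*} [Finite V] (G : SimpleGraph V) : ℕ :=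
  sInf {n | ∃ Γ : Finset (Sym2 V), IsEdgeDominatingSet G Γ ∧ Γ.card = n}

/-- The infimum in the definition of the edge domination number is attained. -/
theorem edgeDominationNumber_isLeast {V : Type*} [Finite V] (G : SimpleGraph V) :
    IsLeast {n | ∃ Γ : Finset (Sym2 V), IsEdgeDominatingSet G Γ ∧ Γ.card = n}
      (edgeDominationNumber G) := by
  refine ⟨Nat.sInf_mem ?_, fun n hn => Nat.sInf_le hn⟩
  have hf : G.edgeSet.Finite := Set.toFinite _
  refine ⟨_, hf.toFinset, ⟨fun e he => by simpa using he, fun e he => ?_⟩, rfl⟩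
  refine ⟨e, by simpa using he, ?_⟩
  induction e with
  | h a b => exact ⟨a, by simp, by simp⟩

/-- The points and lines of `PG(2,F)`: the points are the one-dimensional subspaces of `F³`, and
a line is the set of all points contained in a fixed two-dimensional subspace of `F³`. -/
def pointLineDesign (F : Type*) [Field F] : IncidenceStructure (ℙ F (Fin 3 → F)) where
  blocks := {B | ∃ W : Submodule F (Fin 3 → F), Module.finrank F W = 2 ∧
    B = {x : ℙ F (Fin 3 → F) | x.submodule ≤ W}}

/-- The constant `c` attached to `q = p ^ h`. -/
noncomputable def planeConstant (p h : ℕ) : ℝ :=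
  if p = 2 then (if Even h then 1 else 1 / √2) else (if Even h then 1 / 2 else 0.19)

/-! Lower bound: the points and lines missed by an edge dominating set Γ form an incidence-free
pair. An edge contains one point and one line, so at least q²+q+1-|Γ| of each are missed. The
Cauchy–Schwarz count `incidence_free_bound` limits an incidence-free pair of equal sizes to about
q√q each.

Upper bound: given an incidence-free pair of common size m, Hall's theorem matches the complements
up to 2q elements (`exists_flags_covering_compl`). The flags obtained dominate, so γ_e ≤ q²+3q+1-m,
and pairs with m = c·q√q - O(q) are needed. For p = 2, a Denniston arc and lines missing it are
separated by a functional that kills every c²+c. For square q, slopes and abscissae lie in the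
subfield of order √q, and the additive map y ↦ y^√q - y, which kills it, separates intercepts from
ordinates. For odd powers, slopes and abscissae are polynomials of degree at most k in a generator
of degree 2k+1. The top coefficient of their product is then a small integer mod p, and intervals of
residues do the separating. -/

open Configuration Matrix Projectivization
open scoped Finset

/-! ### Incidence-free pairs and flag coverings in a finite projective plane. -/

namespace Configuration.ProjectivePlane

variable {P L : Type*} [Membership P L] [ProjectivePlane P L] [Fintype L]

open Classical in
theorem card_filter_lines_le_one {p p' : P} (h : p ≠ p') : #{l : L | p ∈ l ∧ p' ∈ l} ≤ 1 := by
  rw [Finset.card_le_one]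
  intro l hl m hm
  simp only [Finset.mem_filter, Finset.mem_univ, true_and] at hl hm
  exact (Nondegenerate.eq_or_eq hl.1 hl.2 hm.1 hm.2).resolve_left h

variable [Fintype P]

open Classical in
theorem card_filter_lines (p : P) : #{l : L | p ∈ l} = order P L + 1 := by
  rw [← lineCount_eq L p, lineCount, Nat.card_eq_fintype_card, Fintype.card_subtype]

open Classical in
/-- The bound of Haemers for a set of points and a set of lines without incidences. -/
theorem incidence_free_bound (S : Finset P) (T : Finset L) (h : ∀ p ∈ S, ∀ l ∈ T, p ∉ l) :
    order P L * (S.card + T.card) + S.card * T.card ≤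
      order P L * (order P L ^ 2 + order P L + 1) := by
  set n := order P L with hn
  have hv : T.card + Tᶜ.card = n ^ 2 + n + 1 := by
    rw [Finset.card_add_card_compl, card_lines P L]
  let a : L → ℕ := fun l => #{p ∈ S | p ∈ l}
  have ha0 : ∀ l ∈ T, a l = 0 := fun l hl =>
    Finset.card_eq_zero.2 (Finset.filter_eq_empty_iff.2 fun p hp => h p hp l hl)
  have hsum : ∀ f : L → ℕ, (∀ l ∈ T, f l = 0) → ∑ l ∈ Tᶜ, f l = ∑ l, f l := by
    intro f hf
    refine Finset.sum_subset (Finset.subset_univ _) fun l _ hl => hf l ?_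
    simpa using hl
  have h1 : ∑ l, a l = S.card * (n + 1) := by
    simp only [a, Finset.card_filter]
    rw [Finset.sum_comm]
    simp only [← Finset.card_filter, card_filter_lines, Finset.sum_const, smul_eq_mul, hn]
  -- Ordered pairs of points of S: the diagonal pair lies on n+1 lines, every other pair on at most
  -- one.
  have h2 : ∑ l, a l ^ 2 ≤ S.card * (n + S.card) := by
    have : ∀ l, a l ^ 2 = ∑ p ∈ S, ∑ p' ∈ S, if p ∈ l ∧ p' ∈ l then 1 else 0 := by
      intro l
      simp only [a, Finset.card_filter, sq, Finset.sum_mul_sum]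
      refine Finset.sum_congr rfl fun p _ => Finset.sum_congr rfl fun p' _ => ?_
      by_cases h1 : p ∈ l <;> by_cases h2 : p' ∈ l <;> simp [h1, h2]
    simp only [this]
    rw [Finset.sum_comm, ← smul_eq_mul]
    refine Finset.sum_le_card_nsmul _ _ _ fun p hp => ?_
    rw [Finset.sum_comm]
    simp only [← Finset.card_filter]
    rw [← Finset.add_sum_erase _ _ hp]
    have e1 : #{l : L | p ∈ l ∧ p ∈ l} = n + 1 := by simp [card_filter_lines, hn]
    have e2 : ∑ x ∈ S.erase p, #{l : L | p ∈ l ∧ x ∈ l} ≤ (S.erase p).card • 1 :=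
      Finset.sum_le_card_nsmul _ _ _ fun x hx =>
        card_filter_lines_le_one (Finset.ne_of_mem_erase hx).symm
    have e3 := Finset.card_erase_add_one hp
    simp only [smul_eq_mul, mul_one] at e2
    omega
  -- Since `a` vanishes on T, Cauchy–Schwarz is needed only over Tᶜ; this is the whole gain.
  have h3 : (∑ l ∈ Tᶜ, a l) ^ 2 ≤ Tᶜ.card * ∑ l ∈ Tᶜ, a l ^ 2 := sq_sum_le_card_mul_sum_sq
  rw [hsum a ha0, hsum (fun l => a l ^ 2) (fun l hl => by simp [ha0 l hl]), h1] at h3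
  have h4 := h3.trans (Nat.mul_le_mul_left _ h2)
  rcases Nat.eq_zero_or_pos S.card with h0 | hpos
  · rw [h0]; nlinarith
  · have h5 : S.card * (n + 1) ^ 2 ≤ Tᶜ.card * (n + S.card) := by
      refine Nat.le_of_mul_le_mul_left ?_ hpos
      nlinarith
    nlinarith

open Classical in
/-- An incidence-free pair of equal size extends to few flags covering all other elements. -/
theorem exists_flags_covering_compl (hq : 9 ≤ order P L) (X : Finset P) (Y : Finset L)
    (hXY : X.card = Y.card) (h : ∀ p ∈ X, ∀ l ∈ Y, p ∉ l) :
    ∃ Γ : Finset (P × L), (∀ e ∈ Γ, e.1 ∈ e.2) ∧ (∀ p ∉ X, ∃ e ∈ Γ, e.1 = p) ∧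
      (∀ l ∉ Y, ∃ e ∈ Γ, e.2 = l) ∧ Γ.card + X.card ≤ order P L ^ 2 + 3 * order P L + 1 := by
  set n := order P L with hn
  have hcX : X.card + Xᶜ.card = n ^ 2 + n + 1 := by
    rw [Finset.card_add_card_compl, card_points P L]
  have hcY : Y.card + Yᶜ.card = n ^ 2 + n + 1 := by
    rw [Finset.card_add_card_compl, card_lines P L]
  -- X has order at most n√n, far below 2n²/3; n ≥ 9 makes this precise.
  have hX : 3 * X.card + 4 * n ≤ 2 * (n ^ 2 + n + 1) := by
    have := incidence_free_bound X Y h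
    rw [← hXY, ← hn] at this
    by_contra! hc
    have h9 : n * 9 ≤ n * n := Nat.mul_le_mul_left _ hq
    nlinarith
  -- The 2n dummy lines, available to every point, turn Hall's theorem into its deficiency version.
  let t : {p // p ∉ X} → Finset (L ⊕ Fin (2 * n)) := fun p =>
    Finset.disjSum {l : L | l ∉ Y ∧ p.1 ∈ l} Finset.univ
  have hall : ∀ s : Finset {p // p ∉ X}, s.card ≤ (s.biUnion t).card := by
    intro s
    rcases s.eq_empty_or_nonempty with rfl | ⟨p0, hp0⟩
    · simp
    let N : Finset L := {l : L | l ∉ Y ∧ ∃ p ∈ s, p.1 ∈ l}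
    have hsub : N.disjSum (Finset.univ : Finset (Fin (2 * n))) ⊆ s.biUnion t := by
      intro z hz
      rcases z with l | i
      · simp only [Finset.inl_mem_disjSum, N, Finset.mem_filter, Finset.mem_univ, true_and] at hz
        obtain ⟨hl, p, hp, hpl⟩ := hz
        exact Finset.mem_biUnion.2 ⟨p, hp, by simp [t, hl, hpl]⟩
      · exact Finset.mem_biUnion.2 ⟨p0, hp0, by simp [t]⟩
    refine le_trans ?_ (Finset.card_le_card hsub)
    rw [Finset.card_disjSum, Finset.card_univ, Fintype.card_fin]
    let S : Finset P := s.map (Function.Embedding.subtype _)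
    let T : Finset L := Yᶜ \ N
    have hS : S.card = s.card := Finset.card_map _
    have hSX : S.card ≤ Xᶜ.card := by
      refine Finset.card_le_card fun p hp => ?_
      obtain ⟨p', -, rfl⟩ := Finset.mem_map.1 hp
      simpa using p'.2
    have hNY : N ⊆ Yᶜ := fun l hl => by simp [N] at hl ⊢; exact hl.1
    have hT : T.card + N.card = Yᶜ.card := Finset.card_sdiff_add_card_eq_card hNY
    -- A violator S of Hall's condition and the lines T outside Y that miss S are themselves
    -- incidence-free.
    have hST := incidence_free_bound S T (by
      intro p hp l hl hpl
      obtain ⟨p', hp', rfl⟩ := Finset.mem_map.1 hp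
      simp only [T, N, Finset.mem_sdiff, Finset.mem_compl, Finset.mem_filter, Finset.mem_univ,
        true_and, not_and, not_exists] at hl
      exact hl.2 hl.1 p' hp' hpl)
    rw [← hn] at hST
    by_contra! hc
    have hn0 : 0 < n := by omega
    have hs2 : 2 * n ≤ S.card := by omega
    have ht2 : 2 * n ≤ T.card := by omega
    have hst : n ^ 2 + n + 1 < X.card + S.card + T.card - 2 * n := by omega
    -- From (|S|-2n)(|T|-2n) ≥ 0 the product term is at least 2n(|S|+|T|)-4n², which makes the bound
    -- linear.
    have : 3 * (S.card + T.card) ≤ n ^ 2 + n + 1 + 4 * n := by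
      obtain ⟨u, hu⟩ := Nat.exists_eq_add_of_le hs2
      obtain ⟨w, hw⟩ := Nat.exists_eq_add_of_le ht2
      rw [hu, hw] at hST ⊢
      refine Nat.le_of_mul_le_mul_left (?_ : n * _ ≤ n * _) hn0
      nlinarith [Nat.zero_le (u * w)]
    omega
  obtain ⟨f, hf, hft⟩ := (Finset.all_card_le_biUnion_card_iff_exists_injective t).1 hall
  have hline : ∀ p : P, ∃ l : L, p ∈ l := by
    intro p
    by_contra! hc
    have := card_filter_lines (P := P) (L := L) p
    simp [hc] at this
  have hpoint : ∀ l : L, ∃ p : P, p ∈ l := by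
    intro l
    by_contra! hc
    have := pointCount_eq P l
    rw [pointCount, Nat.card_eq_fintype_card, Fintype.card_subtype] at this
    simp [hc] at this
  choose ln hln using hline
  choose pt hpt using hpoint
  let g : {p // p ∉ X} → P × L := fun p => (p.1, Sum.elim id (fun _ => ln p.1) (f p))
  let M : Finset L := {l : L | ∃ p, f p = Sum.inl l}
  have hMY : M ⊆ Yᶜ := by
    intro l hl
    obtain ⟨p, hp⟩ := (Finset.mem_filter.1 hl).2
    have := hft p
    rw [hp] at this
    simp [t] at this
    simpa using this.1
  have hM : Xᶜ.card ≤ M.card + 2 * n := by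
    have h1 : (Finset.univ.image f) ⊆ M.disjSum (Finset.univ : Finset (Fin (2 * n))) := by
      intro z hz
      obtain ⟨p, -, rfl⟩ := Finset.mem_image.1 hz
      rcases hfp : f p with l | i
      · simp only [Finset.inl_mem_disjSum, M, Finset.mem_filter, Finset.mem_univ, true_and]
        exact ⟨p, hfp⟩
      · simp
    have h2 := Finset.card_le_card h1
    rw [Finset.card_image_of_injective _ hf, Finset.card_disjSum, Finset.card_univ,
      Finset.card_univ, Fintype.card_fin, Fintype.card_subtype] at h2
    have : Xᶜ = ({p | p ∉ X} : Finset P) := by ext; simp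
    rwa [this]
  -- One flag per point outside X, then an arbitrary flag for each line outside Y left unmatched.
  refine ⟨Finset.univ.image g ∪ (Yᶜ \ M).image fun l => (pt l, l), ?_, ?_, ?_, ?_⟩
  · intro e he
    rcases Finset.mem_union.1 he with he | he
    · obtain ⟨p, -, rfl⟩ := Finset.mem_image.1 he
      have := hft p
      rcases hfp : f p with l | i
      · rw [hfp] at this
        simp [t] at this
        simpa [g, hfp] using this.2
      · simpa [g, hfp] using hln p.1
    · obtain ⟨l, -, rfl⟩ := Finset.mem_image.1 he
      exact hpt l
  · intro p hp
    exact ⟨g ⟨p, hp⟩, Finset.mem_union_left _ (Finset.mem_image_of_mem _ (Finset.mem_univ _)), rfl⟩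
  · intro l hl
    by_cases hlM : l ∈ M
    · obtain ⟨p, hp⟩ := (Finset.mem_filter.1 hlM).2
      exact ⟨g p, Finset.mem_union_left _ (Finset.mem_image_of_mem _ (Finset.mem_univ _)),
        by simp [g, hp]⟩
    · exact ⟨(pt l, l), Finset.mem_union_right _ (Finset.mem_image.2 ⟨l, by simp [hl, hlM], rfl⟩),
        rfl⟩
  · have h1 := Finset.card_union_le (Finset.univ.image g) ((Yᶜ \ M).image fun l => (pt l, l))
    have h2 : (Finset.univ.image g).card ≤ Xᶜ.card := by
      refine Finset.card_image_le.trans (le_of_eq ?_)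
      rw [Finset.card_univ, Fintype.card_subtype]
      congr 1; ext; simp
    have h3 : ((Yᶜ \ M).image fun l => (pt l, l)).card ≤ (Yᶜ \ M).card := Finset.card_image_le
    have h4 : (Yᶜ \ M).card + M.card = Yᶜ.card := Finset.card_sdiff_add_card_eq_card hMY
    omega

/-! ### Edge dominating sets versus incidence-free pairs. -/

section EdgeDomination

variable (D : IncidenceStructure P) (e : L ≃ D.blocks) (he : ∀ p l, p ∈ (e l : Set P) ↔ p ∈ l)
include he

open Classical in
theorem edgeDominationNumber_le (hq : 9 ≤ order P L) (X : Finset P) (Y : Finset L)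
    (hXY : X.card = Y.card) (h : ∀ p ∈ X, ∀ l ∈ Y, p ∉ l) [Finite (P ⊕ D.blocks)] :
    edgeDominationNumber D.incidenceGraph + X.card ≤ order P L ^ 2 + 3 * order P L + 1 := by
  obtain ⟨Γ, hΓ, hP, hL, hcard⟩ := exists_flags_covering_compl hq X Y hXY h
  refine le_trans (Nat.add_le_add_right ?_ _) hcard
  let G : P × L → Sym2 (P ⊕ D.blocks) := fun z => s(Sum.inl z.1, Sum.inr (e z.2))
  refine ((edgeDominationNumber_isLeast D.incidenceGraph).2
    ⟨Γ.image G, ⟨?_, ?_⟩, rfl⟩).trans Finset.card_image_le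
  · intro z hz
    obtain ⟨w, hw, rfl⟩ := Finset.mem_image.1 hz
    exact (he _ _).2 (hΓ w hw)
  · have key : ∀ (p : P) (B : D.blocks), p ∈ (B : Set P) → (∃ e' ∈ Γ.image G, ∃ v, v ∈ e' ∧
        v ∈ s(Sum.inl p, (Sum.inr B : P ⊕ D.blocks))) := by
      intro p B hpB
      obtain ⟨l, rfl⟩ := e.surjective B
      by_cases hp : p ∈ X
      · obtain ⟨z, hz, rfl⟩ := hL l fun hl => h p hp l hl ((he _ _).1 hpB)
        exact ⟨G z, Finset.mem_image_of_mem _ hz, Sum.inr (e z.2), by simp [G], by simp⟩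
      · obtain ⟨z, hz, rfl⟩ := hP p hp
        exact ⟨G z, Finset.mem_image_of_mem _ hz, Sum.inl z.1, by simp [G], by simp⟩
    intro z hz
    induction z with
    | h a b =>
      rcases a with p | B <;> rcases b with p' | B'
      · exact hz.elim
      · exact key p B' hz
      · rw [Sym2.eq_swap]; exact key p' B hz
      · exact hz.elim

open Classical in
theorem le_edgeDominationNumber [Finite (P ⊕ D.blocks)] :
    ∃ x : ℕ, order P L ^ 2 + order P L + 1 ≤ edgeDominationNumber D.incidenceGraph + x ∧
      (x + order P L) ^ 2 ≤ order P L * (order P L + 1) ^ 2 := by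
  obtain ⟨Γ, ⟨hΓ, hdom⟩, hcard⟩ := (edgeDominationNumber_isLeast D.incidenceGraph).1
  rw [← hcard]
  set n := order P L with hn
  let X : Finset P := {p | ∀ z ∈ Γ, Sum.inl p ∉ z}
  let Y : Finset L := {l | ∀ z ∈ Γ, Sum.inr (e l) ∉ z}
  have hcX : X.card + Xᶜ.card = n ^ 2 + n + 1 := by
    rw [Finset.card_add_card_compl, card_points P L]
  have hcY : Y.card + Yᶜ.card = n ^ 2 + n + 1 := by
    rw [Finset.card_add_card_compl, card_lines P L]
  obtain ⟨p₀, -⟩ := exists_config (P := P) (L := L)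
  have : Nonempty (Sym2 (P ⊕ D.blocks)) := ⟨s(Sum.inl p₀, Sum.inl p₀)⟩
  have hX : Xᶜ.card ≤ Γ.card := by
    have : ∀ p ∈ Xᶜ, ∃ z ∈ Γ, Sum.inl p ∈ z := by intro p hp; simpa [X] using hp
    choose! f hf hpf using this
    refine Finset.card_le_card_of_injOn f hf fun p hp p' hp' hpp => ?_
    have h1 := hpf p hp
    have h2 := hpf p' hp'
    rw [← hpp] at h2
    have h3 := hΓ _ (hf p hp)
    by_contra hne
    have h4 := (Sym2.mem_and_mem_iff (by simpa using hne)).1 ⟨h1, h2⟩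
    rw [h4] at h3
    exact h3
  have hY : Yᶜ.card ≤ Γ.card := by
    have : ∀ l ∈ Yᶜ, ∃ z ∈ Γ, Sum.inr (e l) ∈ z := by intro p hp; simpa [Y] using hp
    choose! f hf hpf using this
    refine Finset.card_le_card_of_injOn f hf fun p hp p' hp' hpp => ?_
    have h1 := hpf p hp
    have h2 := hpf p' hp'
    rw [← hpp] at h2
    have h3 := hΓ _ (hf p hp)
    by_contra hne
    have h4 := (Sym2.mem_and_mem_iff (by simpa using hne)).1 ⟨h1, h2⟩
    rw [h4] at h3
    exact h3
  have hb := incidence_free_bound X Y (by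
    intro p hp l hl hpl
    obtain ⟨z, hz, v, hv, hv'⟩ := hdom s(Sum.inl p, Sum.inr (e l)) ((he p l).2 hpl)
    rcases Sym2.mem_iff.1 hv' with rfl | rfl
    · exact (Finset.mem_filter.1 hp).2 z hz hv
    · exact (Finset.mem_filter.1 hl).2 z hz hv)
  rw [← hn] at hb
  -- Truncated subtraction is harmless: x = 0 is still a lower bound for both missed sets.
  refine ⟨n ^ 2 + n + 1 - Γ.card, by omega, ?_⟩
  set x := n ^ 2 + n + 1 - Γ.card
  have h1 : x ≤ X.card := by omega
  have h2 : x ≤ Y.card := by omega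
  have h3 := Nat.mul_le_mul h1 h2
  have h4 : n * (x + x) ≤ n * (X.card + Y.card) := Nat.mul_le_mul_left _ (by omega)
  nlinarith

end EdgeDomination

end Configuration.ProjectivePlane

/-! ### Coordinates: lines as points of the dual plane, incidence as orthogonality. -/

section Field

variable {F : Type*} [Field F]

theorem finrank_ker_dotProduct {w : Fin 3 → F} (hw : w ≠ 0) :
    Module.finrank F (LinearMap.ker (dotProductBilin F F w)) = 2 := by
  have hf : (dotProductBilin F F w : (Fin 3 → F) →ₗ[F] F) ≠ 0 := by
    intro h
    exact hw (dotProduct_eq_zero w fun v => by simpa using LinearMap.congr_fun h v)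
  have h1 := LinearMap.finrank_range_add_finrank_ker
    (dotProductBilin F F w : (Fin 3 → F) →ₗ[F] F)
  rw [LinearMap.range_eq_top.2 (LinearMap.surjective hf), finrank_top] at h1
  simp at h1
  omega

theorem mem_blocks_orthogonal (l : ℙ F (Fin 3 → F)) :
    {x | Projectivization.orthogonal x l} ∈ (pointLineDesign F).blocks := by
  induction l with | h w hw =>
  refine ⟨_, finrank_ker_dotProduct hw, ?_⟩
  ext x
  induction x with | h v hv =>
  simp [orthogonal_mk, dotProduct_comm]

variable [Finite F]

theorem order_eq_card [DecidableEq F] :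
    ProjectivePlane.order (ℙ F (Fin 3 → F)) (ℙ F (Fin 3 → F)) = Nat.card F := by
  have := Fintype.ofFinite (ℙ F (Fin 3 → F))
  have h1 := ProjectivePlane.card_points (ℙ F (Fin 3 → F)) (ℙ F (Fin 3 → F))
  have h2 := Projectivization.card_of_finrank F (Fin 3 → F) (n := 3) (by simp)
  rw [Nat.card_eq_fintype_card, h1] at h2
  simp only [Finset.sum_range_succ, Finset.sum_range_zero] at h2
  nlinarith

/-- Lines of the plane, described by the coordinates of their equations. -/
noncomputable def lineEquiv : ℙ F (Fin 3 → F) ≃ (pointLineDesign F).blocks := by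
  classical
  refine Equiv.ofBijective (fun l => ⟨_, mem_blocks_orthogonal l⟩) ⟨fun l m hlm => ?_, ?_⟩
  · have hlm' : {x | Projectivization.orthogonal x l} = {x | Projectivization.orthogonal x m} :=
      congrArg Subtype.val hlm
    have := Fintype.ofFinite (ℙ F (Fin 3 → F))
    have h := ProjectivePlane.two_lt_pointCount (ℙ F (Fin 3 → F)) l
    rw [pointCount, Nat.card_eq_fintype_card, Fintype.two_lt_card_iff] at h
    obtain ⟨a, b, -, hab, -⟩ := h
    have ha : (a : ℙ F (Fin 3 → F)).orthogonal m := by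
      have : (a : ℙ F (Fin 3 → F)) ∈ {x | Projectivization.orthogonal x l} := a.2
      rwa [hlm'] at this
    have hb : (b : ℙ F (Fin 3 → F)).orthogonal m := by
      have : (b : ℙ F (Fin 3 → F)) ∈ {x | Projectivization.orthogonal x l} := b.2
      rwa [hlm'] at this
    exact (ofField.eq_or_eq_of_orthogonal a.2 b.2 ha hb).resolve_left
      fun h => hab (Subtype.ext h)
  · rintro ⟨B, W, hW, rfl⟩
    have hlt : W < ⊤ := by
      refine lt_top_iff_ne_top.2 fun h => ?_
      rw [h, finrank_top] at hW
      simp at hW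
    obtain ⟨f, hf, hWf⟩ := Submodule.exists_le_ker_of_lt_top W hlt
    let w : Fin 3 → F := fun i => f (Pi.single i 1)
    have hfw : ∀ v, f v = w ⬝ᵥ v := by
      intro v
      rw [LinearMap.pi_apply_eq_sum_univ f v, dotProduct]
      refine Finset.sum_congr rfl fun i _ => ?_
      simp only [w, smul_eq_mul, mul_comm]
      congr 2
      ext j
      simp [Pi.single_apply, eq_comm]
    have hw : w ≠ 0 := by
      intro h
      exact hf (LinearMap.ext fun v => by simp [hfw, h])
    have hker : LinearMap.ker f = LinearMap.ker (dotProductBilin F F w) := by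
      ext v
      simp [hfw]
    have hWk : W = LinearMap.ker f := by
      refine Submodule.eq_of_le_of_finrank_eq hWf ?_
      rw [hW, hker, finrank_ker_dotProduct hw]
    refine ⟨mk F w hw, Subtype.ext ?_⟩
    ext x
    induction x with | h v hv =>
    simp [orthogonal_mk, hWk, hfw, dotProduct_comm]

theorem mem_lineEquiv (p l : ℙ F (Fin 3 → F)) : p ∈ (lineEquiv l : Set (ℙ F (Fin 3 → F))) ↔ p ∈ l :=
  Iff.rfl

theorem exists_le_edgeDominationNumber_pointLineDesign :
    ∃ x : ℕ, Nat.card F ^ 2 + Nat.card F + 1 ≤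
        edgeDominationNumber (pointLineDesign F).incidenceGraph + x ∧
      (x + Nat.card F) ^ 2 ≤ Nat.card F * (Nat.card F + 1) ^ 2 := by
  classical
  have := Fintype.ofFinite (ℙ F (Fin 3 → F))
  have h := ProjectivePlane.le_edgeDominationNumber (pointLineDesign F) lineEquiv mem_lineEquiv
  rwa [order_eq_card] at h

/-- Normalized vectors without orthogonal pairs bound the edge domination number from above. -/
theorem edgeDominationNumber_pointLineDesign_le (hq : 9 ≤ Nat.card F) (S T : Finset (Fin 3 → F))
    {i j : Fin 3} (hS : ∀ v ∈ S, v i = 1) (hT : ∀ w ∈ T, w j = 1)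
    (h : ∀ v ∈ S, ∀ w ∈ T, v ⬝ᵥ w ≠ 0) {x : ℕ} (hxS : x ≤ S.card) (hxT : x ≤ T.card) :
    edgeDominationNumber (pointLineDesign F).incidenceGraph + x ≤
      Nat.card F ^ 2 + 3 * Nat.card F + 1 := by
  classical
  have := Fintype.ofFinite (ℙ F (Fin 3 → F))
  have key : ∀ (R : Finset (Fin 3 → F)) (k : Fin 3), (∀ v ∈ R, v k = 1) → x ≤ R.card →
      ∃ X : Finset (ℙ F (Fin 3 → F)), X.card = x ∧
        ∀ p ∈ X, ∃ v ∈ R, ∃ hv : v ≠ 0, p = mk F v hv := by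
    intro R k hR hx
    have h0 : ∀ v ∈ R, v ≠ 0 := by
      rintro v hv rfl
      simpa using hR 0 hv
    let g : R → ℙ F (Fin 3 → F) := fun v => mk F v.1 (h0 v.1 v.2)
    have hg : Function.Injective g := by
      intro v w hvw
      obtain ⟨a, ha⟩ := (mk_eq_mk_iff' F _ _ _ _).1 hvw
      have h1 := congrFun ha k
      simp only [Pi.smul_apply, hR w.1 w.2, hR v.1 v.2, smul_eq_mul, mul_one] at h1
      rw [h1, one_smul] at ha
      exact Subtype.ext ha.symm
    have hc : x ≤ (Finset.univ.image g).card := by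
      rw [Finset.card_image_of_injective _ hg]
      simpa using hx
    -- Cut down to exactly x, because the covering lemma needs equal sizes.
    obtain ⟨X, hX, hXc⟩ := Finset.exists_subset_card_eq hc
    refine ⟨X, hXc, fun p hp => ?_⟩
    obtain ⟨v, -, rfl⟩ := Finset.mem_image.1 (hX hp)
    exact ⟨v.1, v.2, h0 v.1 v.2, rfl⟩
  obtain ⟨X, hX, hXS⟩ := key S i hS hxS
  obtain ⟨Y, hY, hYT⟩ := key T j hT hxT
  have := ProjectivePlane.edgeDominationNumber_le (pointLineDesign F) lineEquiv mem_lineEquiv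
    (by rwa [order_eq_card]) X Y (hX.trans hY.symm) (by
      intro p hp l hl hpl
      obtain ⟨v, hv, hv0, rfl⟩ := hXS p hp
      obtain ⟨w, hw, hw0, rfl⟩ := hYT l hl
      exact h v hv w hw ((orthogonal_mk hv0 hw0).1 hpl))
  rwa [order_eq_card, hX] at this

end Field

/-! ### Affine constructions for square and odd-power orders. -/

section Constructions

variable {F : Type*} [Field F]

/-- Two polynomials in θ of degree at most k multiply without reduction, the degree staying at most
2k, so the top coefficient is the product of the two coefficients of θ^k. -/
theorem mul_coord_last {K : Type*} [Field K] [Algebra K F] {k : ℕ}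
    (b : Module.Basis (Fin (2 * k + 1)) K F) {θ : F} (hb : ∀ i, b i = θ ^ (i : ℕ)) {x y : F}
    (hx : ∀ i : Fin (2 * k + 1), k < i → b.equivFun x i = 0)
    (hy : ∀ i : Fin (2 * k + 1), k < i → b.equivFun y i = 0) :
    b.equivFun (x * y) (Fin.last _) =
      b.equivFun x ⟨k, by omega⟩ * b.equivFun y ⟨k, by omega⟩ := by
  have hτ : ∀ n (hn : n < 2 * k + 1), b.equivFun (θ ^ n) (Fin.last _) =
      if n = 2 * k then 1 else 0 := by
    intro n hn
    have := hb ⟨n, hn⟩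
    rw [← show b ⟨n, hn⟩ = θ ^ n from this, Module.Basis.equivFun_apply,
      Module.Basis.repr_self, Finsupp.single_apply]
    simp [Fin.ext_iff]
  conv_lhs => rw [← b.sum_equivFun x, ← b.sum_equivFun y, Finset.sum_mul_sum]
  simp only [map_sum, Finset.sum_apply, hb, smul_mul_smul_comm, ← pow_add, map_smul,
    Pi.smul_apply, smul_eq_mul]
  rw [Finset.sum_eq_single ⟨k, by omega⟩, Finset.sum_eq_single ⟨k, by omega⟩, hτ _ (by simp; omega)]
  · simp [two_mul]
  · intro j _ hj
    rcases lt_trichotomy (j : ℕ) k with h | h | h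
    · rw [hτ _ (by simp; omega), if_neg (by simp; omega), mul_zero]
    · exact absurd (Fin.ext h) hj
    · rw [hy j h]; simp
  · simp
  · intro i _ hi
    refine Finset.sum_eq_zero fun j _ => ?_
    by_cases h' : k < (i : ℕ)
    · rw [hx i h']; simp
    by_cases h : k < (j : ℕ)
    · rw [hy j h]; simp
    · have : (i : ℕ) ≠ k := fun h => hi (Fin.ext h)
      rw [hτ _ (by omega), if_neg (by omega), mul_zero]
  · simp

theorem card_filter_pow_eq_mul_le [Fintype F] [DecidableEq F] {n : ℕ} (hn : 1 < n) (c : F) :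
    #{x : F | x ^ n = c * x} ≤ n := by
  have hdeg : (Polynomial.X ^ n - Polynomial.C c * Polynomial.X : Polynomial F).natDegree = n := by
    rw [Polynomial.natDegree_sub_eq_left_of_natDegree_lt, Polynomial.natDegree_X_pow]
    rw [Polynomial.natDegree_X_pow]
    exact (Polynomial.natDegree_C_mul_le c _).trans_lt (by simpa using hn)
  have hne : (Polynomial.X ^ n - Polynomial.C c * Polynomial.X : Polynomial F) ≠ 0 := by
    intro h
    rw [h] at hdeg
    simp at hdeg
    omega
  refine le_trans ?_ (hdeg ▸ Polynomial.card_roots'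
    (Polynomial.X ^ n - Polynomial.C c * Polynomial.X : Polynomial F))
  refine le_trans (Finset.card_le_card fun x hx => ?_) (Multiset.toFinset_card_le _)
  simp only [Finset.mem_filter, Finset.mem_univ, true_and] at hx
  simp [hne, hx]

variable [Finite F]

/-- Points `(x, y)` with `x ∈ A`, `y ∈ S` and lines `y = m x + b` with `m ∈ A`, `b ∈ T`. -/
theorem edgeDominationNumber_le_of_affine (hq : 9 ≤ Nat.card F) (A S T : Finset F)
    (h : ∀ x ∈ A, ∀ m ∈ A, ∀ y ∈ S, ∀ b ∈ T, y ≠ m * x + b) {n : ℕ} (hS : n ≤ S.card)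
    (hT : n ≤ T.card) :
    edgeDominationNumber (pointLineDesign F).incidenceGraph + A.card * n ≤
      Nat.card F ^ 2 + 3 * Nat.card F + 1 := by
  classical
  have hinj : Function.Injective fun z : F × F => ![z.1, z.2, 1] := by
    rintro ⟨a, b⟩ ⟨c, d⟩ hz
    have h0 := congrFun hz 0
    have h1 := congrFun hz 1
    simp at h0 h1
    simp [h0, h1]
  have hinj' : Function.Injective fun z : F × F => ![-z.1, 1, -z.2] := by
    rintro ⟨a, b⟩ ⟨c, d⟩ hz
    have h0 := congrFun hz 0
    have h1 := congrFun hz 2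
    simp at h0 h1
    simp [h0, h1]
  refine edgeDominationNumber_pointLineDesign_le hq
    ((A ×ˢ S).image fun z => ![z.1, z.2, 1]) ((A ×ˢ T).image fun z => ![-z.1, 1, -z.2])
    (i := 2) (j := 1) ?_ ?_ ?_ ?_ ?_
  · simp only [Finset.mem_image]
    rintro v ⟨z, -, rfl⟩
    simp
  · simp only [Finset.mem_image]
    rintro v ⟨z, -, rfl⟩
    simp
  · simp only [Finset.mem_image, Finset.mem_product]
    rintro v ⟨⟨x, y⟩, ⟨hx, hy⟩, rfl⟩ w ⟨⟨m, b⟩, ⟨hm, hb⟩, rfl⟩ hvw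
    refine h x hx m hm y hy b hb ?_
    simp [dotProduct, Fin.sum_univ_three] at hvw
    linear_combination hvw
  · rw [Finset.card_image_of_injective _ hinj, Finset.card_product]
    exact Nat.mul_le_mul_left _ hS
  · rw [Finset.card_image_of_injective _ hinj', Finset.card_product]
    exact Nat.mul_le_mul_left _ hT

theorem AddMonoidHom.card_filter_mem {G H : Type*} [AddGroup G] [Fintype G] [AddGroup H]
    [DecidableEq H] (f : G →+ H) (S : Finset H) (hS : ∀ y ∈ S, y ∈ Set.range f) :
    #{x | f x ∈ S} = S.card * #{x | f x = 0} := by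
  rw [Finset.card_eq_sum_card_fiberwise (f := f) (t := S) (fun x hx => by simpa using hx),
    ← smul_eq_mul]
  refine Finset.sum_const_nat fun y hy => ?_
  rw [← AddMonoidHom.card_fiber_eq_of_mem_range f (hS y hy) ⟨0, map_zero f⟩]
  congr 1
  ext x
  simp only [Finset.mem_filter, Finset.mem_univ, true_and]
  exact ⟨fun h => h.2, fun h => ⟨h ▸ hy, h⟩⟩

/-- The construction from the subfield of order `s = p ^ k` of a field of order `s ^ 2`. -/
theorem edgeDominationNumber_le_of_card_eq_sq (hq : 9 ≤ Nat.card F) {p k : ℕ} (hp : p.Prime)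
    (hF : Nat.card F = (p ^ k) ^ 2) :
    edgeDominationNumber (pointLineDesign F).incidenceGraph + p ^ k * (p ^ k * (p ^ k / 2)) ≤
      Nat.card F ^ 2 + 3 * Nat.card F + 1 := by
  classical
  have := Fintype.ofFinite F
  have : Fact p.Prime := ⟨hp⟩
  have hk : 1 < p ^ k := by
    by_contra! h
    interval_cases p ^ k <;> simp_all
  have : CharP F p := charP_of_card_eq_prime_pow (f := k * 2) (by rw [← Nat.card_eq_fintype_card, hF, pow_mul])
  set s := p ^ k with hs
  -- The kernel K is the subfield of order s. For m, x in K, y = mx+b forces φ y = φ b, so disjoint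
  -- parts of the image of φ give incidence-free sets.
  let φ : F →+ F := (iterateFrobenius F p k : F →+ F) - AddMonoidHom.id F
  have hφ : ∀ x, φ x = x ^ s - x := fun x => by simp [φ, iterateFrobenius_def, hs]
  let K : Finset F := {x | φ x = 0}
  have hKmem : ∀ x, x ∈ K ↔ x ^ s = x := fun x => by simp [K, hφ, sub_eq_zero]
  have hφs : ∀ x, φ x ^ s = -1 * φ x := by
    intro x
    have h1 : x ^ (s ^ 2) = x := by
      rw [← hF, Nat.card_eq_fintype_card, FiniteField.pow_card]
    rw [hφ, hs, sub_pow_char_pow, ← hs, ← pow_mul, ← sq, h1]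
    ring
  let I : Finset F := Finset.univ.image φ
  have hI : I.card ≤ s := by
    refine le_trans (Finset.card_le_card fun x hx => ?_) (card_filter_pow_eq_mul_le hk (-1 : F))
    obtain ⟨y, -, rfl⟩ := Finset.mem_image.1 hx
    simpa using hφs y
  have hK : K.card ≤ s := by
    refine le_trans (Finset.card_le_card fun x hx => ?_) (card_filter_pow_eq_mul_le hk (1 : F))
    simpa using (hKmem x).1 hx
  have hIr : ∀ y ∈ I, y ∈ Set.range φ := fun y hy => by simpa [I] using hy
  -- Image and kernel each have at most s elements, being roots of X^s + X and X^s - X; this product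
  -- forces equality.
  have hIK : I.card * K.card = s ^ 2 := by
    rw [← AddMonoidHom.card_filter_mem φ I hIr, ← hF, Nat.card_eq_fintype_card,
      ← Finset.card_univ]
    congr 1
    ext x
    simp [I]
  have hKs : K.card = s := le_antisymm hK (by nlinarith)
  have hIs : I.card = s := le_antisymm hI (by nlinarith)
  obtain ⟨S, hSI, hS⟩ := Finset.exists_subset_card_eq (s := I) (n := s / 2) (by omega)
  have hT := Finset.card_sdiff_add_card_eq_card hSI
  have h := edgeDominationNumber_le_of_affine hq K {y | φ y ∈ S} {b | φ b ∈ I \ S}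
    (n := s * (s / 2)) (by
      intro x hx m hm y hy b hb hyb
      have hmx : φ (m * x) = 0 := by
        rw [hφ, mul_pow, (hKmem x).1 hx, (hKmem m).1 hm, sub_self]
      simp only [Finset.mem_filter, Finset.mem_univ, true_and, Finset.mem_sdiff] at hy hb
      rw [hyb, map_add, hmx, zero_add] at hy
      exact hb.2 hy)
    (by
      rw [AddMonoidHom.card_filter_mem φ S fun y hy => hIr y (hSI hy), hS, mul_comm]
      exact Nat.mul_le_mul_left _ hKs.ge)
    (by
      rw [AddMonoidHom.card_filter_mem φ _ fun y hy => hIr y (Finset.sdiff_subset hy), mul_comm]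
      exact Nat.mul_le_mul (by omega) hKs.ge)
  rwa [hKs] at h

theorem card_image_intCast_Ico {p : ℕ} {m n : ℤ} (h : n - m ≤ p) :
    ((Finset.Ico m n).image fun c : ℤ => (c : ZMod p)).card = (n - m).toNat := by
  rw [Finset.card_image_of_injOn, Int.card_Ico]
  intro a ha b hb hab
  simp only [Finset.coe_Ico, Set.mem_Ico] at ha hb
  have h1 := (ZMod.intCast_eq_intCast_iff_dvd_sub _ _ _).1 hab
  have := Int.eq_zero_of_abs_lt_dvd h1 (by rw [abs_lt]; omega)
  omega

/-- The construction from a polynomial basis of `𝔽_q` over the prime field. -/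
theorem edgeDominationNumber_le_of_card_eq_odd_pow (hq : 9 ≤ Nat.card F) {p k : ℕ} (hp : p.Prime)
    (hF : Nat.card F = p ^ (2 * k + 1)) {a L : ℕ} (hL : 0 < L) (haL : 2 * L + 2 * a ^ 2 ≤ p) :
    edgeDominationNumber (pointLineDesign F).incidenceGraph +
        p ^ k * (2 * a + 1) * (p ^ (2 * k) * L) ≤ Nat.card F ^ 2 + 3 * Nat.card F + 1 := by
  classical
  have := Fintype.ofFinite F
  have : Fact p.Prime := ⟨hp⟩
  have : CharP F p := charP_of_card_eq_prime_pow (Nat.card_eq_fintype_card.symm.trans hF)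
  let : Algebra (ZMod p) F := ZMod.algebra F p
  have hrank : Module.finrank (ZMod p) F = 2 * k + 1 := by
    have h := Module.card_eq_pow_finrank (K := ZMod p) (V := F)
    rw [ZMod.card, ← Nat.card_eq_fintype_card, hF] at h
    exact (Nat.pow_right_injective hp.two_le h).symm
  let pb := Field.powerBasisOfFiniteOfSeparable (ZMod p) F
  have hdim : pb.dim = 2 * k + 1 := by rw [← pb.finrank, hrank]
  let b : Module.Basis (Fin (2 * k + 1)) (ZMod p) F := pb.basis.reindex (finCongr hdim)
  have hb : ∀ i, b i = pb.gen ^ (i : ℕ) := fun i => by simp [b]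
  -- Products from D lie in [-a², a²]; the gap a² on either side of T', counted cyclically mod p,
  -- keeps S' away from T' shifted by them.
  let D : Finset (ZMod p) := (Finset.Ico (-a : ℤ) (a + 1)).image fun c : ℤ => (c : ZMod p)
  let S' : Finset (ZMod p) := (Finset.Ico (0 : ℤ) L).image fun c : ℤ => (c : ZMod p)
  let T' : Finset (ZMod p) :=
    (Finset.Ico (L + a ^ 2 : ℤ) (2 * L + a ^ 2)).image fun c : ℤ => (c : ZMod p)
  have haL' : 2 * (L : ℤ) + 2 * a ^ 2 ≤ p := by exact_mod_cast haL
  have hD : D.card = 2 * a + 1 := by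
    rw [card_image_intCast_Ico (by nlinarith [sq_nonneg ((a : ℤ) - 1)])]
    omega
  have hS' : S'.card = L := by
    rw [card_image_intCast_Ico (by nlinarith)]
    omega
  have hT' : T'.card = L := by
    rw [card_image_intCast_Ico (by nlinarith)]
    omega
  let t : Fin (2 * k + 1) → Finset (ZMod p) := fun i =>
    if (i : ℕ) < k then Finset.univ else if (i : ℕ) = k then D else {0}
  let A : Finset F := (Fintype.piFinset t).map b.equivFun.symm.toEquiv.toEmbedding
  let U : Finset (ZMod p) → Finset F := fun R =>
    (Fintype.piFinset fun i => if i = Fin.last (2 * k) then R else Finset.univ).map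
      b.equivFun.symm.toEquiv.toEmbedding
  have hA : A.card = p ^ k * (2 * a + 1) := by
    rw [Finset.card_map, Fintype.card_piFinset]
    let f : ℕ → ℕ := fun n => if n < k then p else if n = k then 2 * a + 1 else 1
    have : ∀ i, (t i).card = f i := by
      intro i
      simp only [t, f]
      split_ifs <;> simp [ZMod.card, hD]
    rw [Finset.prod_congr rfl fun i _ => this i, Fin.prod_univ_eq_prod_range f,
      show 2 * k + 1 = k + 1 + k by ring, Finset.prod_range_add, Finset.prod_range_succ,
      Finset.prod_congr (g := fun _ => p) rfl fun i hi => if_pos (Finset.mem_range.1 hi),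
      Finset.prod_const, Finset.card_range, Finset.prod_eq_one, mul_one]
    · simp [f]
    · intro i _
      simp only [f]
      rw [if_neg (by omega), if_neg (by omega)]
  have hU : ∀ R, (U R).card = p ^ (2 * k) * R.card := by
    intro R
    rw [Finset.card_map, Fintype.card_piFinset, Fin.prod_univ_castSucc]
    simp [ZMod.card, Fin.castSucc_ne_last]
  have hbc : ∀ c, b.equivFun (b.equivFun.symm.toEquiv.toEmbedding c) = c :=
    b.equivFun.apply_symm_apply
  have hUmem : ∀ R y, y ∈ U R → b.equivFun y (Fin.last _) ∈ R := by
    intro R y hy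
    obtain ⟨c, hc, rfl⟩ := Finset.mem_map.1 hy
    have := Fintype.mem_piFinset.1 hc (Fin.last _)
    rw [if_pos rfl] at this
    simpa only [hbc] using this
  have hAmem : ∀ x ∈ A, (∀ i : Fin (2 * k + 1), k < i → b.equivFun x i = 0) ∧
      b.equivFun x ⟨k, by omega⟩ ∈ D := by
    intro x hx
    obtain ⟨c, hc, rfl⟩ := Finset.mem_map.1 hx
    rw [Fintype.mem_piFinset] at hc
    refine ⟨fun i hi => ?_, ?_⟩
    · have := hc i
      simp only [t, if_neg hi.not_gt, if_neg hi.ne', Finset.mem_singleton] at this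
      simpa only [hbc] using this
    · have := hc ⟨k, by omega⟩
      simp only [t, lt_irrefl, if_false, if_true] at this
      simpa only [hbc] using this
  have h := edgeDominationNumber_le_of_affine hq A (U S') (U T') (n := p ^ (2 * k) * L) (by
      intro x hx m hm y hy c hc hyc
      obtain ⟨hx0, hxD⟩ := hAmem x hx
      obtain ⟨hm0, hmD⟩ := hAmem m hm
      have h1 := congrArg (fun z => b.equivFun z (Fin.last _)) hyc
      simp only [map_add, Pi.add_apply, mul_coord_last b hb hm0 hx0] at h1
      obtain ⟨X, hX, hX'⟩ := Finset.mem_image.1 hxD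
      obtain ⟨M, hM, hM'⟩ := Finset.mem_image.1 hmD
      obtain ⟨Y, hY, hY'⟩ := Finset.mem_image.1 (hUmem _ _ hy)
      obtain ⟨C, hC, hC'⟩ := Finset.mem_image.1 (hUmem _ _ hc)
      rw [← hX', ← hM', ← hY', ← hC'] at h1
      rw [Finset.mem_Ico] at hX hM hY hC
      have h2 := (ZMod.intCast_eq_intCast_iff_dvd_sub Y (M * X + C) p).1 (by push_cast; exact h1)
      have hXa : |X| ≤ a := abs_le.2 ⟨by omega, by omega⟩
      have hMa : |M| ≤ a := abs_le.2 ⟨by omega, by omega⟩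
      have hMX : |M * X| ≤ (a : ℤ) ^ 2 := by
        rw [abs_mul, sq]
        exact mul_le_mul hMa hXa (abs_nonneg _) (by omega)
      rw [abs_le] at hMX
      -- M X + C - Y lies between 1 and 2L+2a²-1 < p, so p cannot divide it.
      have := Int.eq_zero_of_abs_lt_dvd h2 (by rw [abs_lt]; constructor <;> linarith)
      linarith)
    (by rw [hU, hS']) (by rw [hU, hT'])
  rwa [hA] at h

end Constructions

/-! ### Denniston arcs in characteristic two. -/

theorem Submodule.exists_finrank_eq {K V : Type*} [Field K] [AddCommGroup V] [Module K V]
    [FiniteDimensional K V] {n : ℕ} (hn : n ≤ Module.finrank K V) :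
    ∃ A : Submodule K V, Module.finrank K A = n := by
  let b := Module.finBasis K V
  refine ⟨Submodule.span K (Set.range (b ∘ Fin.castLE hn)), ?_⟩
  rw [finrank_span_eq_card (b.linearIndependent.comp _ (Fin.castLE_injective hn)),
    Fintype.card_fin]

/-- B is the annihilator of A under (c, a) ↦ l(ca): the kernel of a map into the dual of A, whose
rank is at most dim A. -/
theorem exists_submodule_finrank_ge_mul_mem_ker {K F : Type*} [Field K] [Field F] [Algebra K F]
    [FiniteDimensional K F] (l : F →ₗ[K] K) (A : Submodule K F) :
    ∃ B : Submodule K F, Module.finrank K F ≤ Module.finrank K B + Module.finrank K A ∧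
      ∀ a ∈ A, ∀ c ∈ B, l (c * a) = 0 := by
  let f : F →ₗ[K] Module.Dual K A := (Submodule.dualRestrict A).comp ((LinearMap.mul K F).compr₂ l)
  refine ⟨LinearMap.ker f, ?_, fun a ha c hc => ?_⟩
  · have h1 := LinearMap.finrank_range_add_finrank_ker f
    have h2 := Submodule.finrank_le (LinearMap.range f)
    rw [Subspace.dual_finrank_eq] at h2
    omega
  · exact LinearMap.congr_fun hc (⟨a, ha⟩ : A)

section CharTwo

variable {F : Type*} [Field F] [Finite F]

theorem exists_sq_eq_of_charTwo [CharP F 2] (a : F) : ∃ w : F, w ^ 2 = a := by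
  have := Fintype.ofFinite F
  obtain ⟨w, hw⟩ := FiniteField.isSquare_of_char_two (ringChar.eq F 2) a
  exact ⟨w, by rw [hw, sq]⟩

/-- The 𝔽₂-linear map c ↦ c²+c kills 1, so on a finite field it is not onto, and a nonzero
functional vanishes on its range (in effect the absolute trace). -/
theorem exists_linearMap_sq_add_self [Algebra (ZMod 2) F] :
    ∃ l : F →ₗ[ZMod 2] ZMod 2, (∀ c, l (c ^ 2 + c) = 0) ∧ ∃ δ, l δ ≠ 0 := by
  have : CharP F 2 := charP_of_injective_algebraMap (algebraMap (ZMod 2) F).injective 2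
  let ψ : F →+ F := (frobenius F 2 : F →+ F) + AddMonoidHom.id F
  let ψ' : F →ₗ[ZMod 2] F := ψ.toZModLinearMap 2
  have hψ : ∀ c, ψ' c = c ^ 2 + c := fun c => by simp [ψ', ψ, frobenius_def]
  have hlt : LinearMap.range ψ' < ⊤ := by
    refine lt_top_iff_ne_top.2 fun h => ?_
    have hinj := (Finite.injective_iff_surjective (f := ψ')).2 (LinearMap.range_eq_top.1 h)
    have : (1 : F) = 0 := hinj (by rw [hψ, hψ]; simp [CharTwo.add_self_eq_zero])
    exact one_ne_zero this
  obtain ⟨l, hl, hle⟩ := Submodule.exists_le_ker_of_lt_top _ hlt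
  refine ⟨l, fun c => hle ⟨c, hψ c⟩, ?_⟩
  by_contra! h
  exact hl (LinearMap.ext h)

/-- The points of a Denniston maximal arc together with its external lines. -/
theorem edgeDominationNumber_le_of_card_eq_two_pow (hq : 9 ≤ Nat.card F) {h j : ℕ}
    (hF : Nat.card F = 2 ^ h) (hj : 2 * j ≤ h) :
    edgeDominationNumber (pointLineDesign F).incidenceGraph + (2 ^ j - 1) * Nat.card F ≤
      Nat.card F ^ 2 + 3 * Nat.card F + 1 := by
  classical
  have := Fintype.ofFinite F
  have : CharP F 2 := charP_of_card_eq_prime_pow (Nat.card_eq_fintype_card.symm.trans hF)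
  let : Algebra (ZMod 2) F := ZMod.algebra F 2
  have hcard : ∀ W : Submodule (ZMod 2) F, #{x | x ∈ W} = 2 ^ Module.finrank (ZMod 2) W := by
    intro W
    rw [← Fintype.card_subtype, Module.card_eq_pow_finrank (K := ZMod 2) (V := W), ZMod.card]
  have hrank : Module.finrank (ZMod 2) F = h := by
    have h' := Module.card_eq_pow_finrank (K := ZMod 2) (V := F)
    rw [ZMod.card, ← Nat.card_eq_fintype_card, hF] at h'
    exact (Nat.pow_right_injective le_rfl h').symm
  obtain ⟨l, hl, δ, hδ⟩ := exists_linearMap_sq_add_self (F := F)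
  obtain ⟨A, hA⟩ := Submodule.exists_finrank_eq (K := ZMod 2) (V := F) (n := j) (by omega)
  obtain ⟨B, hB, hAB⟩ := exists_submodule_finrank_ge_mul_mem_ker l A
  let N : F → F := fun t => t ^ 2 + t + δ
  have h2 : ∀ a : F, a + a = 0 := CharTwo.add_self_eq_zero
  have hN : ∀ t, N t ≠ 0 := by
    intro t ht
    have h1 : t ^ 2 + t = δ := by
      have := h2 δ
      simp only [N] at ht
      linear_combination ht - this
    exact hδ (h1 ▸ hl t)
  -- Points (t, 1, w) with r w² = N t lie on the conics x²+xy+δy² = r z² of a Denniston pencil; r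
  -- runs over A \ {0}, and dually over B \ {0} for the lines.
  choose w hw using fun (r t : F) => exists_sq_eq_of_charTwo (N t / r)
  have hcardA : ∀ (W : Submodule (ZMod 2) F) (f : F × F → Fin 3 → F), j ≤ Module.finrank (ZMod 2) W →
      (∀ z z', f z = f z' → z.2 = z'.2 ∧ w z.1 z.2 = w z'.1 z'.2) →
      (2 ^ j - 1) * Nat.card F ≤
        (((({x | x ∈ W} : Finset F).erase 0) ×ˢ (Finset.univ : Finset F)).image f).card := by
    intro W f hW hf
    rw [Finset.card_image_of_injOn, Finset.card_product, Finset.card_univ,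
      Nat.card_eq_fintype_card, Finset.card_erase_of_mem (by simp), hcard]
    · exact Nat.mul_le_mul_right _ (Nat.sub_le_sub_right (Nat.pow_le_pow_right two_pos hW) 1)
    · rintro ⟨r, t⟩ hr ⟨r', t'⟩ hr' hrt
      simp only [Finset.coe_product, Set.mem_prod, Finset.mem_coe, Finset.mem_erase] at hr hr'
      obtain ⟨h1, h3⟩ := hf _ _ hrt
      simp only at h1 h3
      subst h1
      have h4 := hw r t
      rw [h3, hw r' t, div_eq_div_iff hr'.1.1 hr.1.1] at h4
      rw [mul_left_cancel₀ (hN t) h4]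
  refine edgeDominationNumber_pointLineDesign_le hq
    (((({x | x ∈ A} : Finset F).erase 0) ×ˢ Finset.univ).image fun z => ![z.2, 1, w z.1 z.2])
    (((({x | x ∈ B} : Finset F).erase 0) ×ˢ Finset.univ).image fun z => ![1, z.2 + 1, w z.1 z.2])
    (i := 1) (j := 0) ?_ ?_ ?_ (hcardA _ _ hA.ge ?_) (hcardA _ _ (by omega) ?_)
  · simp only [Finset.mem_image]
    rintro v ⟨z, -, rfl⟩
    simp
  · simp only [Finset.mem_image]
    rintro v ⟨z, -, rfl⟩
    simp
  · simp only [Finset.mem_image, Finset.mem_product, Finset.mem_erase, Finset.mem_filter,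
      Finset.mem_univ, true_and, and_true]
    rintro v ⟨⟨r, t⟩, ⟨hr0, hr⟩, rfl⟩ u ⟨⟨s, t'⟩, ⟨hs0, hs⟩, rfl⟩ hvu
    simp [dotProduct, Fin.sum_univ_three] at hvu
    have h1 := hw r t
    have h3 := hw s t'
    rw [eq_div_iff hr0] at h1
    rw [eq_div_iff hs0] at h3
    set T := t' + t + 1 with hT
    set c := t * t' + δ with hc
    have hww : w r t * w s t' = T := by
      have := h2 T
      linear_combination hvu - this
    have hTN : T ^ 2 * (s * r) = N t * N t' := by
      rw [← hww]
      linear_combination w s t' ^ 2 * s * h1 + N t * h3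
    have hT0 : T ≠ 0 := by
      intro h0
      rw [h0] at hTN
      simp [hN] at hTN
    -- Multiplicativity of the norm: if ω² = ω+δ, then N t is the norm of t+ω, and (t+ω)(t'+ω) =
    -- c+Tω.
    have hid : N t * N t' = c ^ 2 + c * T + δ * T ^ 2 := by
      simp only [N, hc, hT]
      linear_combination -(2 * t * t' + 1 + t + t') * h2 δ
    -- An incidence would give l(sr) = l(δ) ≠ 0, whereas l(sr) = 0 by the choice of B.
    have hsr : s * r = ((c / T) ^ 2 + c / T) + δ := by
      field_simp
      linear_combination hTN + hid
    have := hAB r hr s hs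
    rw [hsr, map_add, hl, zero_add] at this
    exact hδ this
  · intro z z' hz
    have h0 := congrFun hz 0
    have h1 := congrFun hz 2
    simp at h0 h1
    exact ⟨h0, h1⟩
  · intro z z' hz
    have h0 := congrFun hz 1
    have h1 := congrFun hz 2
    simp at h0 h1
    exact ⟨h0, h1⟩

end CharTwo

/-! ### Numerical estimates and the final bounds. -/

theorem exists_interval_parameters {p : ℕ} (h3 : 3 ≤ p) (hodd : Odd p) :
    ∃ a L : ℕ, 0 < L ∧ 2 * L + 2 * a ^ 2 ≤ p ∧ 0.19 * √(p : ℝ) ^ 3 ≤ (2 * a + 1) * L := by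
  have hcube : ∀ x : ℝ, 0 ≤ x → (p : ℝ) ^ 3 ≤ x ^ 2 → √(p : ℝ) ^ 3 ≤ x := by
    intro x hx h
    refine le_of_sq_le_sq ?_ hx
    rwa [← pow_mul, mul_comm, pow_mul, Real.sq_sqrt (Nat.cast_nonneg p)]
  by_cases h7 : p < 7
  · have : p = 3 ∨ p = 5 := by
      obtain ⟨m, rfl⟩ := hodd
      omega
    rcases this with rfl | rfl
    -- The only admissible pair for p = 3; its ratio 3^(-3/2) = 0.192… is why the constant 0.19
    -- cannot be raised much here.
    · refine ⟨0, 1, by norm_num, by norm_num, ?_⟩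
      have := hcube (100 / 19) (by norm_num) (by norm_num)
      norm_num at this ⊢
      linarith
    · refine ⟨1, 1, by norm_num, by norm_num, ?_⟩
      have := hcube 12 (by norm_num) (by norm_num)
      norm_num at this ⊢
      linarith
  push Not at h7
  set t := √(p : ℝ) with ht
  have ht2 : t ^ 2 = p := Real.sq_sqrt (Nat.cast_nonneg p)
  have ht0 : 0 ≤ t := Real.sqrt_nonneg _
  have h7' : (7 : ℝ) ≤ t ^ 2 := by rw [ht2]; exact_mod_cast h7
  -- The product 2a(p/2-a²) peaks at a = √(p/6) ≈ 0.41√p; 2/5 is a convenient nearby ratio.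
  obtain ⟨a, ha⟩ : ∃ a, a = ⌊2 * t / 5⌋₊ := ⟨_, rfl⟩
  have ha1 : (a : ℝ) ≤ 2 * t / 5 := ha ▸ Nat.floor_le (by positivity)
  have ha2 : 2 * t / 5 < a + 1 := ha ▸ Nat.lt_floor_add_one _
  have ha0 : 1 ≤ a := by
    rw [ha]
    refine Nat.le_floor ?_
    push_cast
    nlinarith
  have ha0' : (1 : ℝ) ≤ a := by exact_mod_cast ha0
  have hap : 25 * a ^ 2 ≤ 4 * p := by
    have : 25 * (a : ℝ) ^ 2 ≤ 4 * p := by rw [← ht2]; nlinarith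
    exact_mod_cast this
  obtain ⟨m, hm⟩ := hodd
  have hLm : a ^ 2 < m := by omega
  refine ⟨a, m - a ^ 2, by omega, by omega, ?_⟩
  rw [Nat.cast_sub hLm.le]
  have hm' : (m : ℝ) = (t ^ 2 - 1) / 2 := by
    rw [ht2, hm]
    push_cast
    ring
  rw [hm']
  push_cast
  have h1 : 0 ≤ t * ((t - 5 / 2 * a) * (5 / 2 * (a + 1) - t)) :=
    mul_nonneg ht0 (mul_nonneg (by linarith) (by linarith))
  have h2 : 5 / 2 * (a : ℝ) ≤ t := by linarith
  have h4 : (5 / 2 * (a : ℝ)) ^ 2 * (0.1 * a + 0.05) ≤ t ^ 2 * (0.1 * a + 0.05) :=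
    mul_le_mul_of_nonneg_right (pow_le_pow_left₀ (by positivity) h2 2) (by positivity)
  have h5 : 2.375 * (a : ℝ) * (a + 1) * (5 / 2 * a) ≤ 2.375 * a * (a + 1) * t :=
    mul_le_mul_of_nonneg_left h2 (by positivity)
  have h6 : (1 : ℝ) ≤ a ^ 2 := one_le_pow₀ ha0'
  have h8 : (a : ℝ) ≤ a ^ 2 := by nlinarith
  have h9 : (1 : ℝ) ≤ a ^ 3 := one_le_pow₀ ha0'
  nlinarith

/-- Taking roots gives x ≤ √q(q+1)-q; the leftover 2q+1-√q is positive, so no error term of order q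
is needed below. -/
theorem sq_sub_mul_sqrt_le {q x e : ℝ} (hq : 1 ≤ q) (h : q ^ 2 + q + 1 ≤ e + x)
    (hxq : (x + q) ^ 2 ≤ q * (q + 1) ^ 2) : q ^ 2 - q * √q ≤ e := by
  have h1 : x + q ≤ √q * (q + 1) := by
    refine le_of_sq_le_sq ?_ (by positivity)
    rwa [mul_pow, Real.sq_sqrt (by linarith)]
  have h2 : √q ≤ q := by
    rw [Real.sqrt_le_left (by linarith)]
    nlinarith
  nlinarith

theorem upper_bound_of_card_eq_pow {F : Type*} [Field F] [Finite F] {p h : ℕ} (hp : p.Prime)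
    (hq : 9 ≤ Nat.card F) (hF : Nat.card F = p ^ h) :
    (edgeDominationNumber (pointLineDesign F).incidenceGraph : ℝ) ≤
      (Nat.card F : ℝ) ^ 2 - planeConstant p h * (Nat.card F * √(Nat.card F : ℝ)) +
        5 * Nat.card F := by
  have hq' : (9 : ℝ) ≤ Nat.card F := by exact_mod_cast hq
  by_cases h2 : p = 2
  · subst h2
    -- The largest arc degree with 2j ≤ h is 2^⌊h/2⌋; for odd h the rounding costs the factor 1/√2.
    have key : planeConstant 2 h * √(Nat.card F : ℝ) = 2 ^ (h / 2) := by
      have hF' : (Nat.card F : ℝ) = 2 ^ h := by exact_mod_cast hF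
      rw [hF']
      rcases Nat.even_or_odd' h with ⟨k, rfl | rfl⟩
      · rw [planeConstant, if_pos rfl, if_pos (even_two_mul k), one_mul, mul_comm 2 k, pow_mul,
          Real.sqrt_sq (by positivity), Nat.mul_div_cancel _ two_pos]
      · rw [planeConstant, if_pos rfl, if_neg (by simp), pow_succ, mul_comm 2 k, pow_mul,
          Real.sqrt_mul (by positivity), Real.sqrt_sq (by positivity),
          show (k * 2 + 1) / 2 = k by omega]
        field_simp
    have hmain := edgeDominationNumber_le_of_card_eq_two_pow hq hF (j := h / 2) (by omega)
    have h1 : 1 ≤ 2 ^ (h / 2) := Nat.one_le_two_pow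
    have hmain' : (edgeDominationNumber (pointLineDesign F).incidenceGraph : ℝ) +
        (2 ^ (h / 2) - 1) * Nat.card F ≤ (Nat.card F : ℝ) ^ 2 + 3 * Nat.card F + 1 := by
      have := Nat.cast_le (α := ℝ).2 hmain
      push_cast [Nat.cast_sub h1] at this
      exact this
    rw [mul_left_comm, key]
    nlinarith
  have hodd : Odd p := hp.odd_of_ne_two h2
  have h3 : 3 ≤ p := by
    have := hp.two_le
    omega
  rcases Nat.even_or_odd' h with ⟨k, rfl | rfl⟩
  · have hF' : Nat.card F = (p ^ k) ^ 2 := by rw [hF, ← pow_mul, mul_comm]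
    have hmain := edgeDominationNumber_le_of_card_eq_sq hq hp hF'
    set s := p ^ k
    -- Halving the odd number s loses 1/2, that is q/2 in the final count, which 5q absorbs.
    have hs : s ≤ 2 * (s / 2) + 1 := by omega
    have hmain' : (edgeDominationNumber (pointLineDesign F).incidenceGraph : ℝ) +
        s * (s * (s / 2 : ℕ)) ≤ (Nat.card F : ℝ) ^ 2 + 3 * Nat.card F + 1 := by
      exact_mod_cast hmain
    have hs' : (s : ℝ) ≤ 2 * (s / 2 : ℕ) + 1 := by exact_mod_cast hs
    have hsF : (Nat.card F : ℝ) = (s : ℝ) ^ 2 := by exact_mod_cast hF'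
    rw [planeConstant, if_neg h2, if_pos (even_two_mul k)]
    rw [hsF] at hmain' hq' ⊢
    rw [Real.sqrt_sq (Nat.cast_nonneg s)]
    have := mul_le_mul_of_nonneg_left hs' (sq_nonneg (s : ℝ))
    nlinarith
  · obtain ⟨a, L, hL, haL, hbound⟩ := exists_interval_parameters h3 hodd
    have hmain := edgeDominationNumber_le_of_card_eq_odd_pow hq hp hF hL haL
    have hmain' : (edgeDominationNumber (pointLineDesign F).incidenceGraph : ℝ) +
        (p : ℝ) ^ k * (2 * a + 1) * (p ^ (2 * k) * L) ≤
          (Nat.card F : ℝ) ^ 2 + 3 * Nat.card F + 1 := by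
      exact_mod_cast hmain
    have hF' : (Nat.card F : ℝ) = p ^ (2 * k + 1) := by exact_mod_cast hF
    have hroot : √(Nat.card F : ℝ) = p ^ k * √(p : ℝ) := by
      rw [hF', pow_succ, mul_comm 2 k, pow_mul, Real.sqrt_mul (by positivity),
        Real.sqrt_sq (by positivity)]
    have hqq : (Nat.card F : ℝ) * √(Nat.card F : ℝ) = p ^ (3 * k) * √(p : ℝ) ^ 3 := by
      rw [hroot, hF', pow_succ √(p : ℝ) 2, Real.sq_sqrt (Nat.cast_nonneg p)]
      ring
    rw [planeConstant, if_neg h2, if_neg (by simp), hqq]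
    have h5 := mul_le_mul_of_nonneg_left hbound (by positivity : (0 : ℝ) ≤ p ^ (3 * k))
    have h6 : (p : ℝ) ^ k * (2 * a + 1) * (p ^ (2 * k) * L) =
        p ^ (3 * k) * ((2 * a + 1) * L) := by ring
    rw [h6] at hmain'
    linarith

theorem corollary6p2 :
    ∃ C : ℝ, ∀ (p h q : ℕ), p.Prime → 1 ≤ h → q = p ^ h → 101 ≤ q →
      ∀ (F : Type*) [Field F] [Finite F], Nat.card F = q →
        (q : ℝ) ^ 2 - q * √(q : ℝ) - C * q ≤
            (edgeDominationNumber (pointLineDesign F).incidenceGraph : ℝ) ∧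
          (edgeDominationNumber (pointLineDesign F).incidenceGraph : ℝ) ≤
            (q : ℝ) ^ 2 - planeConstant p h * (q * √(q : ℝ)) + C * q := by
  refine ⟨5, fun p h q hp _ hqp hq F _ _ hF => ?_⟩
  subst hF
  refine ⟨?_, upper_bound_of_card_eq_pow hp (by omega) hqp⟩
  obtain ⟨x, hx, hxq⟩ := exists_le_edgeDominationNumber_pointLineDesign (F := F)
  have hq' : (101 : ℝ) ≤ Nat.card F := by exact_mod_cast hq
  have := sq_sub_mul_sqrt_le (q := Nat.card F) (x := x)
    (e := edgeDominationNumber (pointLineDesign F).incidenceGraph) (by linarith)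
    (by exact_mod_cast hx) (by exact_mod_cast hxq)
  linarith
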